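/- Let $P$ be the set of prime numbers. All groups are abelian. A characteristic is a family $\chi=(\chi_p)_{p\in P}$ with $\chi_p\in\{0,1,2,\dots\}\cup\{\infty\}$; two characteristics are equivalent if they differ at only finitely many primes, and only at primes where both are finite. A type $t$ is an equivalence class of characteristics; put $P_\infty(t)=\{p\in P : \chi_p=\infty\}$ and $P_0(t)=P\setminus P_\infty(t)$, where $\chi\in t$ (the choice of $\chi$ does not matter). The product of types is induced by the pointwise sum of characteristics, and $t$ is idempotent if $t\cdot t=t$. The type of an element $g$ of a torsion-free group is the class of the family of its $p$-heights. A nonzero torsion-free group is homogeneous of type $t$ if all its nonzero elements have type $t$. A Murley group is a reduced torsion-free group $G$ of finite rank such that $\dim_{\mathbb{F}_p} G/pG\le 1$ for every prime $p$. A torsion-free group $G$ of finite rank is quotient divisible if it has a free subgroup $F$ such that $G/F$ is a divisible torsion group. For a torsion-free group $G$ of finite rank put $V=\mathbb{Q}\otimes G$ and $V^{(p)}=\mathbb{Q}_p\otimes G\supseteq V$, and let $\delta_p(G)$ be the maximal divisible subgroup of $\mathbb{Z}_pG$, the $\mathbb{Z}_p$-submodule of $V^{(p)}$ generated by $G$ (here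 $\mathbb{Z}_p$ and $\mathbb{Q}_p$ are the $p$-adic integers and numbers). The family $(\delta_p(G))_{p\in P}$ is the quotient divisible invariant (q.d.-invariant) of $G$. For $P_1\subseteq P$, a family $(\alpha_p)_{p\in P_1}$ with $\alpha_p\in\mathbb{Z}_p$ satisfies condition $(T)$ for $m$ if for every nonzero polynomial $f\in\mathbb{Z}[x]$ of degree at most $m$ we have $f(\alpha_p)\ne 0$ for all $p\in P_1$, and $f(\alpha_p)\not\equiv 0 \pmod p$ for all but finitely many $p\in P_1$. **Lemma 13.** Let $n>1$ be an integer, let $t$ be a type different from the type of $(\infty,\infty,\dots)$, and let $\alpha_p\in\mathbb{Z}_p$, $p\in P_0(t)$, be a family that satisfies condition $(T)$ for $n-1$. Then there is a Murley group $G$ of rank $n$, homogeneous of type $t$, such that the following hold. 1. For some basis $e_1,\dots,e_n$ of the $\mathbb{Q}$-space $V=\mathbb{Q}\otimes G$, we have $\delta_p(G)=V^{(p)}$ for all $p\in P_\infty(t)$, and $\delta_p(G)$ is the $\mathbb{Q}_p$-subspace of $V^{(p)}$ spanned by $e_1+\alpha_pe_2,\ e_2+\alpha_pe_3,\ \dots,\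 e_{n-1}+\alpha_pe_n$ for all $p\in P_0(t)$. 2. If $t$ is idempotent, then $G$ is quotient divisible. -/

import Mathlib

open scoped TensorProduct

namespace AbelianGroups

instance factPrimePrimes (p : Nat.Primes) : Fact (Nat.Prime (p : ℕ)) := ⟨p.2⟩

/-- A characteristic: a family of non-negative integers or symbols `∞`, indexed by the primes. -/
abbrev Characteristic : Type := Nat.Primes → ℕ∞

/-- Two characteristics are equivalent if they differ in at most finitely many places,
and at each of these places both values are finite. -/
def Characteristic.Equiv (χ ψ : Characteristic) : Prop :=
  {p | χ p ≠ ψ p}.Finite ∧ ∀ p, χ p ≠ ψ p → χ p ≠ ⊤ ∧ ψ p ≠ ⊤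

theorem Characteristic.equiv_equivalence : Equivalence Characteristic.Equiv where
  refl χ := ⟨by simp, fun p h => absurd rfl h⟩
  symm := by
    rintro χ ψ ⟨h, h'⟩
    refine ⟨h.subset fun p hp => Ne.symm hp, fun p hp => (h' p hp.symm).symm⟩
  trans := by
    rintro χ ψ φ ⟨h₁, h₁'⟩ ⟨h₂, h₂'⟩
    refine ⟨(h₁.union h₂).subset fun p hp => ?_, fun p hp => ?_⟩
    · by_contra hc
      simp only [Set.mem_union, Set.mem_ofPred_eq, not_or, not_not] at hc
      exact hp (hc.1.trans hc.2)
    · have a := h₁' p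
      have b := h₂' p
      by_cases e₁ : χ p = ψ p
      · have := b (e₁ ▸ hp)
        exact ⟨e₁ ▸ this.1, this.2⟩
      · by_cases e₂ : ψ p = φ p
        · have := a e₁
          exact ⟨this.1, e₂ ▸ this.2⟩
        · exact ⟨(a e₁).1, (b e₂).2⟩

instance Characteristic.setoid : Setoid Characteristic :=
  ⟨Characteristic.Equiv, Characteristic.equiv_equivalence⟩

/-- A type: an equivalence class of characteristics. -/
def GroupType : Type := Quotient Characteristic.setoid

/-- The type of a characteristic. -/
def GroupType.mk (χ : Characteristic) : GroupType := Quotient.mk _ χ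

/-- The product of types, induced by the pointwise sum of characteristics. -/
instance GroupType.instMul : Mul GroupType :=
  ⟨Quotient.map₂ (fun χ ψ p => χ p + ψ p) (by
    rintro χ χ' ⟨h₁, h₁'⟩ ψ ψ' ⟨h₂, h₂'⟩
    refine ⟨(h₁.union h₂).subset fun p hp => ?_, fun p hp => ?_⟩
    · by_contra hc
      simp only [Set.mem_union, Set.mem_ofPred_eq, not_or, not_not] at hc
      exact hp (by simp only [hc.1, hc.2])
    · have a := h₁' p
      have b := h₂' p
      by_cases e₁ : χ p = χ' p <;> by_cases e₂ : ψ p = ψ' p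
      · exact absurd (by simp [e₁, e₂]) hp
      · obtain ⟨b₁, b₂⟩ := b e₂
        have : χ' p ≠ ⊤ := fun h => hp (by simp [e₁, h])
        simp [e₁, this, b₁, b₂]
      · obtain ⟨a₁, a₂⟩ := a e₁
        have : ψ' p ≠ ⊤ := fun h => hp (by simp [e₂, h])
        simp [e₂, this, a₁, a₂]
      · obtain ⟨a₁, a₂⟩ := a e₁
        obtain ⟨b₁, b₂⟩ := b e₂
        simp [a₁, a₂, b₁, b₂])⟩

/-- The set `P_∞(t)` of the primes at which the characteristics in `t` are infinite. -/
def GroupType.PInfty (t : GroupType) : Set Nat.Primes :=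
  {p | Quotient.lift (fun χ : Characteristic => χ p = ⊤) (by
    rintro χ ψ ⟨-, h⟩
    by_cases e : χ p = ψ p
    · simp [e]
    · simp [h p e]) t}

/-- The set `P_0(t)` of the primes at which the characteristics in `t` are finite. -/
def GroupType.PZero (t : GroupType) : Set Nat.Primes := (t.PInfty)ᶜ

section Groups

variable (G : Type*) [AddCommGroup G]

/-- Divisible groups. -/
def IsDivisible : Prop := ∀ m : ℕ, m ≠ 0 → ∀ x : G, ∃ y : G, m • y = x

/-- Reduced groups: those whose only divisible subgroup is zero. -/
def IsReducedGroup : Prop := ∀ D : AddSubgroup G, IsDivisible D → D = ⊥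

/-- The `p`-rank of a torsion-free group: the dimension of `G / pG` over the field with
`p` elements. -/
noncomputable def pRank (p : Nat.Primes) : Cardinal :=
  Module.rank (ZMod (p : ℕ)) (ModN G (p : ℕ))

/-- Murley groups: reduced torsion-free groups of finite rank all of whose `p`-ranks are
at most `1`. -/
structure IsMurley : Prop where
  torsionFree : IsAddTorsionFree G
  finiteRank : Module.rank ℤ G < Cardinal.aleph0
  reduced : IsReducedGroup G
  pRank_le_one : ∀ p : Nat.Primes, pRank G p ≤ 1

/-- Quotient divisible groups: torsion-free groups of finite rank with a free subgroup `F` such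
that `G / F` is a divisible torsion group. -/
structure IsQuotientDivisible : Prop where
  torsionFree : IsAddTorsionFree G
  finiteRank : Module.rank ℤ G < Cardinal.aleph0
  exists_free : ∃ F : AddSubgroup G,
    Module.Free ℤ F ∧ IsDivisible (G ⧸ F) ∧ IsAddTorsion (G ⧸ F)

variable {G}

/-- The characteristic of an element: its value at `p` is the `p`-height, the supremum of the
`k` such that `p ^ k` divides the element. -/
noncomputable def characteristic (g : G) : Characteristic :=
  fun p => ⨆ (k : ℕ) (_ : ∃ x : G, (p : ℕ) ^ k • x = g), (k : ℕ∞)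

/-- The type of an element. -/
noncomputable def elementType (g : G) : GroupType := GroupType.mk (characteristic g)

/-- The largest divisible subgroup of a subgroup `A` (the sum of all of them). -/
def divisiblePart (A : AddSubgroup G) : AddSubgroup G :=
  sSup {D : AddSubgroup G | D ≤ A ∧ IsDivisible D}

/-- `divisiblePart A` is indeed the largest divisible subgroup of `A`. -/
theorem divisiblePart_isGreatest (A : AddSubgroup G) :
    IsGreatest {D : AddSubgroup G | D ≤ A ∧ IsDivisible D} (divisiblePart A) := by
  refine ⟨⟨sSup_le fun D hD => hD.1, ?_⟩, fun D hD => le_sSup hD⟩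
  rintro m hm ⟨x, hx⟩
  have key : divisiblePart A ≤ (divisiblePart A).map (DistribSMul.toAddMonoidHom G m) := by
    refine sSup_le fun D hD x hx => ?_
    obtain ⟨y, hy⟩ := hD.2 m hm ⟨x, hx⟩
    exact ⟨y, (le_sSup hD : D ≤ _) y.2, congrArg Subtype.val hy⟩
  obtain ⟨y, hy, hyx⟩ := key hx
  exact ⟨⟨y, hy⟩, Subtype.ext hyx⟩

variable (G)

/-- A group is homogeneous of type `t` if all its nonzero elements have type `t`. -/
def IsHomogeneousOfType (t : GroupType) : Prop := ∀ g : G, g ≠ 0 → elementType g = t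

/-- The divisible hull `ℚ ⊗ G` of a torsion-free group `G`. -/
abbrev DivisibleHull : Type _ := ℚ ⊗[ℤ] G

/-- The space `V^(p) = ℚ_p ⊗ G`. -/
abbrev PAdicHull (p : Nat.Primes) : Type _ := ℚ_[(p : ℕ)] ⊗[ℤ] G

/-- The canonical map from `ℚ ⊗ G` to `ℚ_p ⊗ G`, induced by the inclusion of `ℚ` in `ℚ_p`. -/
noncomputable def hullMap (p : Nat.Primes) : DivisibleHull G →ₗ[ℤ] PAdicHull G p :=
  LinearMap.rTensor G (algebraMap ℚ ℚ_[(p : ℕ)]).toAddMonoidHom.toIntLinearMap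

/-- The `p`-adic integer span of `G` in `ℚ_p ⊗ G`. -/
noncomputable def pAdicSpan (p : Nat.Primes) : Submodule ℤ_[(p : ℕ)] (PAdicHull G p) :=
  Submodule.span ℤ_[(p : ℕ)] (Set.range fun g : G => (1 : ℚ_[(p : ℕ)]) ⊗ₜ[ℤ] g)

/-- The component at `p` of the quotient divisible invariant of `G`: the maximal divisible
subgroup of the `p`-adic integer span of `G`. -/
noncomputable def qdInvariant (p : Nat.Primes) : AddSubgroup (PAdicHull G p) :=
  divisiblePart (pAdicSpan G p).toAddSubgroup

end Groups

/-- Condition `(T)` for `m`, for a family of `p`-adic integers indexed by a set of primes: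
every nonzero integer polynomial `f` of degree at most `m` vanishes at no `α p`, and
`f (α p)` is divisible by `p` for only finitely many `p`. -/
def ConditionT {P₁ : Set Nat.Primes} (α : ∀ p : P₁, ℤ_[(p.1 : ℕ)]) (m : ℕ) : Prop :=
  ∀ f : Polynomial ℤ, f ≠ 0 → f.natDegree ≤ m →
    (∀ p : P₁, Polynomial.aeval (α p) f ≠ 0) ∧
    {p : P₁ | ((p.1 : ℕ) : ℤ_[(p.1 : ℕ)]) ∣ Polynomial.aeval (α p) f}.Finite

end AbelianGroups

/-!
The group is cut out of `ℚⁿ` by one inequality at each prime of `P₀(t)`. The subspace of `ℚ_pⁿ`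
spanned by the vectors `e_s + α_p e_{s+1}` is the kernel of the functional
`φ_p(y) = ∑ y_i (-α_p)^(n-1-i)`. Choose a characteristic `χ` in `t`, and put
`G = {x ∈ ℚⁿ | p ^ χ_p φ_p(x) ∈ ℤ_p for all p ∈ P₀(t)}` (`heightGroup`).

Everything is read off from the rule that `p ^ k` divides `x` in `G` exactly if `p ∈ P_∞(t)` or
`χ_p + v_p(φ_p(x)) ≥ k` (`exists_pow_smul_eq_iff`), which holds because division by `p` does not
affect the conditions at the other primes.

* For rational `x ≠ 0`, the number `φ_p(x)` is, up to a fixed denominator, the value at `α_p` of a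
  nonzero integer polynomial of degree at most `n - 1`. By condition `(T)` it is nonzero for all `p`
  and a unit for almost all `p`. So the `p`-height of `x` is finite on `P₀(t)` and almost everywhere
  equal to `χ_p`: the group is homogeneous of type `t` and, as `P₀(t)` is nonempty, reduced.
* The rule for `k = 1` says that `φ_p` embeds `G / pG` in `p ^ (-χ_p) ℤ_p / p ^ (1 - χ_p) ℤ_p`, whose
  order is `p`.
* The `ℤ_p`-span of `G` lies in `{y | φ_p(y) ∈ p ^ (-χ_p) ℤ_p}`, whose divisible subgroups lie in the
  kernel of `φ_p`. Conversely, the kernel lies in the span: a vector `y` of it is the sum of a vector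
  over `ℤ[1/p]` and one over `ℤ_p`, and the first of these belongs to `G`, because its image under
  `φ_p` is integral (`sum_smul_mem_pAdicSpan`).
* If `t` is idempotent, `χ` can be chosen with values `0` and `∞`. Then `φ_p(x)` is a `p`-adic
  integer for every `x ∈ G`, and subtracting an integer multiple of the last unit vector, on which
  `φ_p` is `1`, makes `x` divisible by `p`. Hence `G = pG + ℤⁿ` for all `p`, and `G / ℤⁿ` is
  divisible.
-/

open scoped TensorProduct

namespace AbelianGroups

/-! ### The functionals and the group -/

section HeightGroup

variable {n : ℕ} {S : Set Nat.Primes} (α : ∀ p : S, ℤ_[(p.1 : ℕ)]) (c : S → ℕ)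

/-- The functional `y ↦ ∑ y_i (-α_p)^(n-1-i)` on `ℚ_pⁿ`; its kernel is spanned by the vectors
`e_s + α_p e_{s+1}`. The indices run from `0` to `n - 1`. -/
noncomputable def padicFunctional (p : S) :
    (Fin n → ℚ_[(p.1 : ℕ)]) →ₗ[ℚ_[(p.1 : ℕ)]] ℚ_[(p.1 : ℕ)] :=
  Fintype.linearCombination _ fun i : Fin n => (-(α p : ℚ_[(p.1 : ℕ)])) ^ (n - 1 - (i : ℕ))

theorem padicFunctional_apply (p : S) (y : Fin n → ℚ_[(p.1 : ℕ)]) :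
    padicFunctional α p y = ∑ i, y i * (-(α p : ℚ_[(p.1 : ℕ)])) ^ (n - 1 - (i : ℕ)) := rfl

/-- The restriction of `padicFunctional` to rational vectors, as a `ℚ`-linear map. -/
noncomputable def ratFunctional (p : S) : (Fin n → ℚ) →ₗ[ℚ] ℚ_[(p.1 : ℕ)] :=
  Fintype.linearCombination ℚ fun i : Fin n => (-(α p : ℚ_[(p.1 : ℕ)])) ^ (n - 1 - (i : ℕ))

theorem ratFunctional_apply (p : S) (x : Fin n → ℚ) :
    ratFunctional α p x = padicFunctional α p (fun i => (x i : ℚ_[(p.1 : ℕ)])) := by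
  simp [ratFunctional, padicFunctional_apply, Fintype.linearCombination_apply, Algebra.smul_def]

theorem norm_ratFunctional_smul (p : S) (r : ℚ) (x : Fin n → ℚ) :
    ‖ratFunctional α p (r • x)‖ = ‖(r : ℚ_[(p.1 : ℕ)])‖ * ‖ratFunctional α p x‖ := by
  rw [map_smul, Algebra.smul_def, norm_mul, eq_ratCast]

theorem norm_padicFunctional_le_one (p : S) {y : Fin n → ℚ_[(p.1 : ℕ)]} (hy : ∀ i, ‖y i‖ ≤ 1) :
    ‖padicFunctional α p y‖ ≤ 1 := by
  let w : Fin n → ℤ_[(p.1 : ℕ)] := fun i => ⟨y i, hy i⟩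
  have : padicFunctional α p y =
      ((∑ i, w i * (-α p) ^ (n - 1 - (i : ℕ)) : ℤ_[(p.1 : ℕ)]) : ℚ_[(p.1 : ℕ)]) := by
    rw [padicFunctional_apply, PadicInt.coe_sum]; push_cast; rfl
  rw [this]
  exact PadicInt.norm_le_one _

/-- The group of the rational vectors `x` such that `p ^ c_p φ_p(x)` is a `p`-adic integer for every
`p` in `S`, where `φ_p` is the functional `ratFunctional α p`. Nothing is required at the primes
outside `S`. -/
def heightGroup (n : ℕ) (α : ∀ p : S, ℤ_[(p.1 : ℕ)]) (c : S → ℕ) : AddSubgroup (Fin n → ℚ) where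
  carrier := {x | ∀ p, ‖ratFunctional α p x‖ ≤ ((p.1 : ℕ) : ℝ) ^ (c p : ℤ)}
  zero_mem' p := by simp
  add_mem' {x y} hx hy p := by
    rw [map_add]
    exact (Padic.nonarchimedean _ _).trans (max_le (hx p) (hy p))
  neg_mem' {x} hx p := by simpa using hx p

variable {α c}

theorem mem_heightGroup_of_le_one {x : Fin n → ℚ} (h : ∀ p, ‖ratFunctional α p x‖ ≤ 1) :
    x ∈ heightGroup n α c := fun p =>
  (h p).trans (by
    rw [zpow_natCast]
    exact one_le_pow₀ (by exact_mod_cast p.1.2.one_le))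

theorem norm_prime_eq_one {p q : Nat.Primes} (h : p ≠ q) : ‖((p : ℕ) : ℚ_[(q : ℕ)])‖ = 1 := by
  rw [Padic.norm_natCast_eq_one_iff]
  exact (Nat.coprime_primes q.2 p.2).2 fun e => h (Subtype.ext e.symm)

theorem intCast_mem_heightGroup (z : Fin n → ℤ) : (fun i => (z i : ℚ)) ∈ heightGroup n α c :=
  mem_heightGroup_of_le_one fun p => by
    rw [ratFunctional_apply]
    exact norm_padicFunctional_le_one α p fun i => by simpa using Padic.norm_int_le_one (z i)

/-- Divisibility by `p ^ k` in the group depends on the condition at `p` only, because `p` is a unit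
of `ℤ_q` for every other prime `q`. -/
theorem exists_pow_smul_eq_iff (p : Nat.Primes) (x : heightGroup n α c) (k : ℕ) :
    (∃ y : heightGroup n α c, (p : ℕ) ^ k • y = x) ↔
      ∀ h : p ∈ S, ‖ratFunctional α ⟨p, h⟩ (x : Fin n → ℚ)‖ ≤
        ((p : ℕ) : ℝ) ^ ((c ⟨p, h⟩ : ℤ) - k) := by
  have hp0 : ((p : ℕ) : ℝ) ≠ 0 := by exact_mod_cast p.2.ne_zero
  have hp0' : ((p : ℕ) : ℚ) ≠ 0 := by exact_mod_cast p.2.ne_zero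
  have hpos : (0 : ℝ) < ((p : ℕ) : ℝ) := by exact_mod_cast p.2.pos
  constructor
  · rintro ⟨y, rfl⟩ h
    have e : (((p : ℕ) ^ k • y : heightGroup n α c) : Fin n → ℚ) =
        (((p : ℕ) : ℚ) ^ k) • (y : Fin n → ℚ) := by
      ext i; simp
    have hy := y.2 ⟨p, h⟩
    rw [e, norm_ratFunctional_smul, sub_eq_add_neg, zpow_add₀ hp0, mul_comm]
    push_cast
    rw [Padic.norm_p_pow]
    gcongr
  · intro H
    refine ⟨⟨(((p : ℕ) : ℚ) ^ k)⁻¹ • (x : Fin n → ℚ), fun q => ?_⟩, ?_⟩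
    · rw [norm_ratFunctional_smul]
      push_cast
      by_cases e : p = q.1
      · obtain ⟨q, hq⟩ := q
        obtain rfl : p = q := e
        have := H hq
        rw [norm_inv, Padic.norm_p_pow, zpow_neg, inv_inv]
        calc _ ≤ ((p : ℕ) : ℝ) ^ (k : ℤ) * ((p : ℕ) : ℝ) ^ ((c ⟨p, hq⟩ : ℤ) - k) := by gcongr
          _ = _ := by rw [← zpow_add₀ hp0]; congr 1; ring
      · rw [norm_inv, norm_pow, norm_prime_eq_one e]
        simpa using x.2 q
    · ext i
      simp [hp0']

theorem exists_pow_smul_eq_of_notMem {p : Nat.Primes} (hp : p ∉ S) (x : heightGroup n α c)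
    (k : ℕ) : ∃ y : heightGroup n α c, (p : ℕ) ^ k • y = x :=
  (exists_pow_smul_eq_iff p x k).2 fun h => absurd h hp

theorem exists_smul_eq_iff_norm_lt (p : S) (x : heightGroup n α c) :
    (∃ y : heightGroup n α c, (p.1 : ℕ) • y = x) ↔
      ‖ratFunctional α p (x : Fin n → ℚ)‖ < ((p.1 : ℕ) : ℝ) ^ (c p : ℤ) := by
  have := exists_pow_smul_eq_iff p.1 x 1
  rw [pow_one] at this
  rw [this, ← sub_add_cancel (c p : ℤ) 1, ← Padic.norm_le_pow_iff_norm_lt_pow_add_one]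
  simp [p.2]

/-! ### Heights and types -/

theorem characteristic_eq_top {p : Nat.Primes} (hp : p ∉ S) (x : heightGroup n α c) :
    characteristic x p = ⊤ := by
  rw [ENat.eq_top_iff_forall_ge]
  intro k
  exact le_iSup₂_of_le (f := fun (k : ℕ) (_ : ∃ y : heightGroup n α c, (p : ℕ) ^ k • y = x) =>
    (k : ℕ∞)) k (exists_pow_smul_eq_of_notMem hp x k) le_rfl

theorem exists_not_exists_pow_smul (p : S) {x : heightGroup n α c}
    (hx : ratFunctional α p (x : Fin n → ℚ) ≠ 0) :
    ∃ K : ℕ, ∀ k : ℕ, (∃ y : heightGroup n α c, (p.1 : ℕ) ^ k • y = x) → k < K := by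
  have hp1 : (1 : ℝ) < ((p.1 : ℕ) : ℝ) := by exact_mod_cast p.1.2.one_lt
  have hp0 : (0 : ℝ) < ((p.1 : ℕ) : ℝ) := by linarith
  have hx' : 0 < ‖ratFunctional α p (x : Fin n → ℚ)‖ := norm_pos_iff.2 hx
  obtain ⟨K, hK⟩ := pow_unbounded_of_one_lt
    (((p.1 : ℕ) : ℝ) ^ (c p : ℤ) / ‖ratFunctional α p (x : Fin n → ℚ)‖) hp1
  refine ⟨K, fun k hk => ?_⟩
  by_contra! hKk
  have h1 := (exists_pow_smul_eq_iff p.1 x k).1 hk p.2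
  rw [zpow_sub₀ hp0.ne', zpow_natCast _ k, le_div_iff₀ (by positivity), mul_comm,
    ← le_div_iff₀ hx'] at h1
  exact absurd (hK.trans_le (pow_le_pow_right₀ hp1.le hKk)) h1.not_gt

theorem characteristic_ne_top (p : S) {x : heightGroup n α c}
    (hx : ratFunctional α p (x : Fin n → ℚ) ≠ 0) : characteristic x p.1 ≠ ⊤ := by
  obtain ⟨K, hK⟩ := exists_not_exists_pow_smul p hx
  refine ne_top_of_le_ne_top (ENat.natCast_ne_top K) (iSup₂_le fun k hk => ?_)
  exact_mod_cast (hK k hk).le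

theorem characteristic_eq (p : S) {x : heightGroup n α c}
    (hx : ‖ratFunctional α p (x : Fin n → ℚ)‖ = 1) : characteristic x p.1 = c p := by
  have hp1 : (1 : ℝ) < ((p.1 : ℕ) : ℝ) := by exact_mod_cast p.1.2.one_lt
  have key : ∀ k : ℕ, (∃ y : heightGroup n α c, (p.1 : ℕ) ^ k • y = x) ↔ k ≤ c p := by
    intro k
    rw [exists_pow_smul_eq_iff]
    have : (1 : ℝ) = ((p.1 : ℕ) : ℝ) ^ (0 : ℤ) := by simp
    simp only [p.2, forall_true_left, Subtype.coe_eta, hx]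
    rw [this, zpow_le_zpow_iff_right₀ hp1]
    omega
  refine le_antisymm (iSup₂_le fun k hk => ?_) ?_
  · exact_mod_cast (key k).1 hk
  · exact le_iSup₂_of_le (f := fun (k : ℕ)
      (_ : ∃ y : heightGroup n α c, (p.1 : ℕ) ^ k • y = x) => (k : ℕ∞)) (c p)
      ((key _).2 le_rfl) le_rfl

theorem exists_natCast_smul_eq_intCast (x : Fin n → ℚ) :
    ∃ N : ℕ, N ≠ 0 ∧ ∃ z : Fin n → ℤ, (N : ℚ) • x = fun i => (z i : ℚ) := by
  refine ⟨∏ i, (x i).den, Finset.prod_ne_zero_iff.2 fun i _ => (x i).den_ne_zero,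
    fun i => (x i).num * ∏ j ∈ Finset.univ.erase i, ((x j).den : ℤ), ?_⟩
  ext i
  rw [Pi.smul_apply, smul_eq_mul, ← Finset.mul_prod_erase _ _ (Finset.mem_univ i)]
  push_cast
  nth_rewrite 2 [← Rat.num_div_den (x i)]
  have : ((x i).den : ℚ) ≠ 0 := by exact_mod_cast (x i).den_ne_zero
  field_simp

open Polynomial in
/-- Under condition `(T)`, the values of the functionals at a nonzero rational vector are nonzero,
and almost all of them are units: up to a common denominator they are the values of one integer
polynomial. -/
theorem ConditionT.ratFunctional (hα : ConditionT α (n - 1)) {x : Fin n → ℚ} (hx : x ≠ 0) :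
    (∀ p, ratFunctional α p x ≠ 0) ∧ {p : S | ‖ratFunctional α p x‖ ≠ 1}.Finite := by
  obtain ⟨N, hN, z, hz⟩ := exists_natCast_smul_eq_intCast x
  have hN' : (N : ℚ) ≠ 0 := by exact_mod_cast hN
  set f : ℤ[X] := ∑ i : Fin n, C (z i) * (-X) ^ (n - 1 - (i : ℕ)) with hf
  have hfα : ∀ p : S, ((aeval (α p) f : ℤ_[(p.1 : ℕ)]) : ℚ_[(p.1 : ℕ)]) =
      N * AbelianGroups.ratFunctional α p x := by
    intro p
    have : (N : ℚ_[(p.1 : ℕ)]) * AbelianGroups.ratFunctional α p x =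
        AbelianGroups.ratFunctional α p ((N : ℚ) • x) := by
      rw [map_smul, Algebra.smul_def]; simp
    rw [this, hz, ratFunctional_apply, padicFunctional_apply, hf]
    simp [map_sum]
  have hdeg : f.natDegree ≤ n - 1 := by
    refine natDegree_sum_le_of_forall_le _ _ fun i _ => ?_
    refine (natDegree_C_mul_le _ _).trans ((natDegree_pow_le).trans ?_)
    rw [natDegree_neg, natDegree_X]
    omega
  have hf0 : f ≠ 0 := by
    intro h0
    apply hx
    have hz0 : ∀ i, z i = 0 := by
      intro j
      have hc : f.coeff (n - 1 - (j : ℕ)) = 0 := by rw [h0, coeff_zero]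
      rw [hf, finsetSum_coeff, Finset.sum_eq_single j] at hc
      · rw [neg_pow, ← mul_assoc, ← C_1, ← C_neg, ← C_pow, ← C_mul, coeff_C_mul_X_pow] at hc
        simpa using hc
      · intro i _ hij
        rw [neg_pow, ← mul_assoc, ← C_1, ← C_neg, ← C_pow, ← C_mul, coeff_C_mul_X_pow, if_neg]
        have := i.2; have := j.2
        intro h
        exact hij (Fin.ext (by omega))
      · simp
    have : (N : ℚ) • x = 0 := by rw [hz]; ext i; simp [hz0 i]
    exact (smul_eq_zero.1 this).resolve_left hN'
  obtain ⟨h1, h2⟩ := hα f hf0 hdeg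
  refine ⟨fun p h => h1 p ?_, ?_⟩
  · have := hfα p
    rw [h, mul_zero] at this
    exact Subtype.coe_injective this
  -- `φ_p(x)` is a unit unless `p` divides the value of `f` or the denominator `N`.
  · have hfin : {p : S | (p.1 : ℕ) ∣ N}.Finite := by
      have : Set.InjOn (fun p : S => (p.1 : ℕ)) {p : S | (p.1 : ℕ) ∣ N} :=
        fun p _ q _ h => Subtype.ext (Subtype.ext h)
      refine Set.Finite.of_finite_image ((Set.finite_Iic N).subset ?_) this
      rintro _ ⟨p, hp, rfl⟩
      exact Nat.le_of_dvd (Nat.pos_of_ne_zero hN) hp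
    refine (h2.union hfin).subset fun p hp => ?_
    by_contra hc
    simp only [Set.mem_union, Set.mem_ofPred_eq, not_or] at hc
    apply hp
    have e1 : ‖((aeval (α p) f : ℤ_[(p.1 : ℕ)]) : ℚ_[(p.1 : ℕ)])‖ = 1 := by
      rw [← PadicInt.norm_def]
      refine le_antisymm (PadicInt.norm_le_one _) (not_lt.1 fun h => hc.1 ?_)
      exact (PadicInt.norm_lt_one_iff_dvd _).1 h
    have e2 : ‖(N : ℚ_[(p.1 : ℕ)])‖ = 1 := by
      rw [Padic.norm_natCast_eq_one_iff]
      exact (Nat.Prime.coprime_iff_not_dvd p.1.2).2 hc.2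
    rw [hfα p, norm_mul, e2, one_mul] at e1
    exact e1

theorem elementType_heightGroup (hα : ConditionT α (n - 1)) {χ : Characteristic}
    (hS : ∀ p, p ∉ S → χ p = ⊤) (hc : ∀ p : S, χ p.1 = c p)
    {x : heightGroup n α c} (hx : x ≠ 0) : elementType x = GroupType.mk χ := by
  obtain ⟨h1, h2⟩ := hα.ratFunctional (x := (x : Fin n → ℚ)) (by simpa using hx)
  refine Quotient.sound ⟨(h2.image Subtype.val).subset fun p hp => ?_, fun p hp => ?_⟩
  · by_cases h : p ∈ S
    · refine ⟨⟨p, h⟩, fun e => hp ?_, rfl⟩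
      rw [hc ⟨p, h⟩]
      exact characteristic_eq ⟨p, h⟩ e
    · exact absurd ((characteristic_eq_top h x).trans (hS p h).symm) hp
  · by_cases h : p ∈ S
    · refine ⟨characteristic_ne_top ⟨p, h⟩ (h1 _), ?_⟩
      rw [hc ⟨p, h⟩]
      exact ENat.natCast_ne_top _
    · exact absurd ((characteristic_eq_top h x).trans (hS p h).symm) hp

/-! ### Reducedness and `p`-ranks -/

theorem isReducedGroup_heightGroup (hα : ConditionT α (n - 1)) (hS : S.Nonempty) :
    IsReducedGroup (heightGroup n α c) := by
  intro D hD
  obtain ⟨p, hp⟩ := hS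
  refine (AddSubgroup.eq_bot_iff_forall _).2 fun x hx => ?_
  by_contra hx0
  obtain ⟨h1, -⟩ := hα.ratFunctional (x := (x : Fin n → ℚ)) (by simpa using hx0)
  obtain ⟨K, hK⟩ := exists_not_exists_pow_smul ⟨p, hp⟩ (h1 ⟨p, hp⟩)
  obtain ⟨y, hy⟩ := hD (p ^ K) (pow_ne_zero _ p.2.ne_zero) ⟨x, hx⟩
  exact (hK K ⟨y, congrArg Subtype.val hy⟩).false

theorem exists_natCast_norm_sub_lt_one (p : Nat.Primes) {y : ℚ_[(p : ℕ)]} (hy : ‖y‖ ≤ 1) :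
    ∃ r : ℕ, ‖y - r‖ < 1 := by
  let u : ℤ_[(p : ℕ)] := ⟨y, hy⟩
  obtain ⟨r, -, hr⟩ := PadicInt.exists_mem_range u
  rw [IsLocalRing.mem_maximalIdeal, PadicInt.mem_nonunits, PadicInt.norm_def, PadicInt.coe_sub,
    PadicInt.coe_natCast] at hr
  exact ⟨r, hr⟩

theorem pRank_heightGroup_le_one (p : Nat.Primes) : pRank (heightGroup n α c) p ≤ 1 := by
  have hzero : ∀ x : heightGroup n α c, (∃ y : heightGroup n α c, (p : ℕ) • y = x) →
      ModN.mkQ (p : ℕ) x = 0 := by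
    rintro x ⟨y, rfl⟩
    exact (Submodule.Quotient.mk_eq_zero _).2 ⟨y, by simp⟩
  have hsurj : Function.Surjective (ModN.mkQ (G := heightGroup n α c) (p : ℕ)) :=
    Submodule.mkQ_surjective _
  rw [pRank, rank_le_one_iff]
  by_cases hall : ∀ x : heightGroup n α c, ∃ y : heightGroup n α c, (p : ℕ) • y = x
  · refine ⟨0, fun v => ⟨0, ?_⟩⟩
    obtain ⟨x, rfl⟩ := hsurj v
    rw [hzero x (hall x), smul_zero]
  · push Not at hall
    obtain ⟨g, hg⟩ := hall
    have hp : p ∈ S := by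
      by_contra h
      obtain ⟨y, hy⟩ := exists_pow_smul_eq_of_notMem h g 1
      exact hg y (by simpa using hy)
    -- An element `g` outside `pG` has the largest norm allowed, and generates `G` modulo `pG`.
    have hg' : ‖ratFunctional α ⟨p, hp⟩ (g : Fin n → ℚ)‖ = ((p : ℕ) : ℝ) ^ (c ⟨p, hp⟩ : ℤ) := by
      refine le_antisymm (g.2 ⟨p, hp⟩) (not_lt.1 fun h => ?_)
      obtain ⟨y, hy⟩ := (exists_smul_eq_iff_norm_lt ⟨p, hp⟩ g).2 h
      exact hg y hy
    have hpos : 0 < ‖ratFunctional α ⟨p, hp⟩ (g : Fin n → ℚ)‖ := by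
      rw [hg']
      have : (0 : ℝ) < ((p : ℕ) : ℝ) := by exact_mod_cast p.2.pos
      positivity
    refine ⟨ModN.mkQ (p : ℕ) g, fun v => ?_⟩
    obtain ⟨x, rfl⟩ := hsurj v
    obtain ⟨r, hr⟩ := exists_natCast_norm_sub_lt_one p
      (y := ratFunctional α ⟨p, hp⟩ (x : Fin n → ℚ) / ratFunctional α ⟨p, hp⟩ (g : Fin n → ℚ)) (by
        rw [norm_div, div_le_one hpos, hg']
        exact x.2 ⟨p, hp⟩)
    refine ⟨(r : ZMod (p : ℕ)), ?_⟩
    rw [Nat.cast_smul_eq_nsmul, ← map_nsmul, eq_comm, ← sub_eq_zero, ← map_sub]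
    apply hzero
    refine (exists_smul_eq_iff_norm_lt ⟨p, hp⟩ _).2 ?_
    have e : ratFunctional α ⟨p, hp⟩ ((x - r • g : heightGroup n α c) : Fin n → ℚ) =
        (ratFunctional α ⟨p, hp⟩ (x : Fin n → ℚ) / ratFunctional α ⟨p, hp⟩ (g : Fin n → ℚ) - r) *
          ratFunctional α ⟨p, hp⟩ (g : Fin n → ℚ) := by
      rw [sub_mul, div_mul_cancel₀ _ (norm_pos_iff.1 hpos)]
      rw [AddSubgroup.coe_sub, AddSubgroup.coe_nsmul, map_sub, map_nsmul, nsmul_eq_mul]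
    rw [e, norm_mul, ← hg']
    exact mul_lt_of_lt_one_left hpos hr

/-! ### The hulls of the group -/

variable (α c) in
/-- The `i`-th unit vector of `ℚⁿ`, as an element of the group. -/
def unitVec (i : Fin n) : heightGroup n α c :=
  ⟨fun j => ((Pi.single i 1 : Fin n → ℤ) j : ℚ), intCast_mem_heightGroup _⟩

theorem coe_unitVec (i : Fin n) : (unitVec α c i : Fin n → ℚ) = Pi.single i 1 := by
  ext j
  by_cases h : j = i
  · subst h; simp [unitVec]
  · simp [unitVec, h]

/-- Over a field of characteristic zero, elements of the group decompose into unit vectors, although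
their coordinates are rational numbers that do not act on the group itself. -/
theorem tmul_eq_sum (K : Type*) [Field K] [CharZero K] (x : heightGroup n α c) :
    (1 : K) ⊗ₜ[ℤ] x = ∑ i, (((x : Fin n → ℚ) i : ℚ) : K) • ((1 : K) ⊗ₜ[ℤ] unitVec α c i) := by
  obtain ⟨N, hN, z, hz⟩ := exists_natCast_smul_eq_intCast (x : Fin n → ℚ)
  have hN' : (N : K) ≠ 0 := by exact_mod_cast hN
  have hx : N • x = ∑ i, z i • unitVec α c i := by
    ext j
    have := congrFun hz j
    simp only [Pi.smul_apply, smul_eq_mul] at this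
    simp [coe_unitVec, Pi.single_apply, this]
  have hi : ∀ i, (N : K) * (((x : Fin n → ℚ) i : ℚ) : K) = z i := by
    intro i
    have := congrFun hz i
    simp only [Pi.smul_apply, smul_eq_mul] at this
    exact_mod_cast congrArg (Rat.cast : ℚ → K) this
  apply smul_right_injective _ hN'
  simp only [Finset.smul_sum, smul_smul, hi]
  rw [Nat.cast_smul_eq_nsmul, ← TensorProduct.tmul_smul, hx, TensorProduct.tmul_sum]
  refine Finset.sum_congr rfl fun i _ => ?_
  rw [TensorProduct.tmul_smul, Int.cast_smul_eq_zsmul]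

theorem exists_eq_sum_smul (K : Type*) [Field K] [CharZero K]
    (y : K ⊗[ℤ] heightGroup n α c) :
    ∃ a : Fin n → K, y = ∑ i, a i • ((1 : K) ⊗ₜ[ℤ] unitVec α c i) := by
  induction y with
  | zero => exact ⟨0, by simp⟩
  | tmul b x =>
    refine ⟨fun i => b * (((x : Fin n → ℚ) i : ℚ) : K), ?_⟩
    have : b ⊗ₜ[ℤ] x = b • ((1 : K) ⊗ₜ[ℤ] x) := by rw [TensorProduct.smul_tmul']; simp
    rw [this, tmul_eq_sum, Finset.smul_sum]
    simp only [smul_smul]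
  | add y y' h h' =>
    obtain ⟨a, rfl⟩ := h
    obtain ⟨a', rfl⟩ := h'
    exact ⟨a + a', by simp [add_smul, Finset.sum_add_distrib]⟩

variable (n α c) in
/-- The unit vectors, as a basis of `ℚ ⊗ G`. -/
noncomputable def hullBasis : Module.Basis (Fin n) ℚ (DivisibleHull (heightGroup n α c)) :=
  .mk (v := fun i => (1 : ℚ) ⊗ₜ[ℤ] unitVec α c i)
    (by
      let f : DivisibleHull (heightGroup n α c) →ₗ[ℚ] (Fin n → ℚ) :=
        (heightGroup n α c).subtype.toIntLinearMap.liftBaseChange ℚ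
      refine LinearIndependent.of_comp f ?_
      have : f ∘ (fun i => (1 : ℚ) ⊗ₜ[ℤ] unitVec α c i) = Pi.basisFun ℚ (Fin n) := by
        ext1 i
        simp [f, coe_unitVec]
      rw [this]
      exact (Pi.basisFun ℚ (Fin n)).linearIndependent)
    (by
      rintro y -
      obtain ⟨a, rfl⟩ := exists_eq_sum_smul ℚ y
      exact sum_mem fun i _ => Submodule.smul_mem _ _ (Submodule.subset_span ⟨i, rfl⟩))

theorem hullMap_hullBasis (p : Nat.Primes) (i : Fin n) :
    hullMap (heightGroup n α c) p (hullBasis n α c i) = 1 ⊗ₜ[ℤ] unitVec α c i := by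
  rw [hullBasis, Module.Basis.mk_apply, hullMap]
  refine (LinearMap.rTensor_tmul _ _ _ _).trans ?_
  simp

theorem rank_heightGroup : Module.rank ℤ (heightGroup n α c) = n := by
  rw [← (TensorProduct.isBaseChange ℤ (heightGroup n α c) ℚ).rank_eq,
    rank_eq_card_basis (hullBasis n α c), Fintype.card_fin]

theorem isMurley_heightGroup (hα : ConditionT α (n - 1)) (hS : S.Nonempty) :
    IsMurley (heightGroup n α c) where
  torsionFree := inferInstance
  finiteRank := by rw [rank_heightGroup]; exact Cardinal.natCast_lt_aleph0
  reduced := isReducedGroup_heightGroup hα hS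
  pRank_le_one := pRank_heightGroup_le_one

/-! ### The quotient divisible invariant -/

/-- A `p`-adic number is congruent modulo `ℤ_p` to an element of `ℤ[1/p]`. -/
theorem exists_rat_norm_sub_le_one (p : Nat.Primes) (y : ℚ_[(p : ℕ)]) :
    ∃ x : ℚ, ‖y - x‖ ≤ 1 ∧ ∀ q : Nat.Primes, q ≠ p → ‖(x : ℚ_[(q : ℕ)])‖ ≤ 1 := by
  have hp1 : (1 : ℝ) < ((p : ℕ) : ℝ) := by exact_mod_cast p.2.one_lt
  have hp0 : ((p : ℕ) : ℚ_[(p : ℕ)]) ≠ 0 := by exact_mod_cast p.2.ne_zero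
  obtain ⟨k, hk⟩ := pow_unbounded_of_one_lt ‖y‖ hp1
  have hu : ‖y * (p : ℕ) ^ k‖ ≤ 1 := by
    rw [norm_mul, Padic.norm_p_pow, zpow_neg, zpow_natCast, ← div_eq_mul_inv,
      div_le_one (by positivity)]
    exact hk.le
  set u : ℤ_[(p : ℕ)] := ⟨y * (p : ℕ) ^ k, hu⟩ with hudef
  have ha := (PadicInt.norm_le_pow_iff_mem_span_pow _ _).2 (PadicInt.appr_spec k u)
  refine ⟨(u.appr k : ℚ) / ((p : ℕ) : ℚ) ^ k, ?_, fun q hq => ?_⟩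
  · have e : y - (((u.appr k : ℚ) / ((p : ℕ) : ℚ) ^ k : ℚ) : ℚ_[(p : ℕ)]) =
        ((u - (u.appr k : ℤ_[(p : ℕ)]) : ℤ_[(p : ℕ)]) : ℚ_[(p : ℕ)]) / (p : ℕ) ^ k := by
      rw [PadicInt.coe_sub, PadicInt.coe_natCast, hudef]
      push_cast
      field_simp
    rw [e, norm_div, Padic.norm_p_pow]
    rw [PadicInt.norm_def] at ha
    exact (div_le_one (by positivity)).2 ha
  · push_cast
    rw [norm_div, norm_pow, norm_prime_eq_one hq.symm, one_pow, div_one]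
    exact_mod_cast Padic.norm_int_le_one (p := (q : ℕ)) (u.appr k : ℤ)

/-- A vector of `ℚ_p ⊗ G` on which the functional at `p` (if there is one) is integral lies in the
`p`-adic span of `G`: it is the sum of an element of `G` and a vector with coordinates in `ℤ_p`. -/
theorem sum_smul_mem_pAdicSpan (p : Nat.Primes) (y : Fin n → ℚ_[(p : ℕ)])
    (hy : ∀ h : p ∈ S, ‖padicFunctional α ⟨p, h⟩ y‖ ≤ 1) :
    ∑ i, y i • ((1 : ℚ_[(p : ℕ)]) ⊗ₜ[ℤ] unitVec α c i) ∈ pAdicSpan (heightGroup n α c) p := by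
  -- `x` is a vector over `ℤ[1/p]`, so that it is integral at all primes other than `p`.
  choose x hx hxq using fun i => exists_rat_norm_sub_le_one p (y i)
  have hxG : x ∈ heightGroup n α c := by
    refine mem_heightGroup_of_le_one fun q => ?_
    rw [ratFunctional_apply]
    by_cases e : q.1 = p
    · obtain ⟨q, hq⟩ := q
      obtain rfl : q = p := e
      have : (fun i => (x i : ℚ_[(q : ℕ)])) = y - fun i => y i - x i := by ext i; simp
      rw [this, map_sub, sub_eq_add_neg]
      refine (Padic.nonarchimedean _ _).trans (max_le (hy hq) ?_)
      rw [norm_neg]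
      exact norm_padicFunctional_le_one α _ hx
    · exact norm_padicFunctional_le_one α q fun i => hxq i q.1 e
  let w : Fin n → ℤ_[(p : ℕ)] := fun i => ⟨y i - x i, hx i⟩
  have e : ∑ i, y i • ((1 : ℚ_[(p : ℕ)]) ⊗ₜ[ℤ] unitVec α c i) =
      (1 : ℚ_[(p : ℕ)]) ⊗ₜ[ℤ] (⟨x, hxG⟩ : heightGroup n α c) +
        ∑ i, w i • ((1 : ℚ_[(p : ℕ)]) ⊗ₜ[ℤ] unitVec α c i) := by
    rw [tmul_eq_sum, ← Finset.sum_add_distrib]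
    refine Finset.sum_congr rfl fun i _ => ?_
    have : w i • ((1 : ℚ_[(p : ℕ)]) ⊗ₜ[ℤ] unitVec α c i) =
        (y i - x i) • ((1 : ℚ_[(p : ℕ)]) ⊗ₜ[ℤ] unitVec α c i) := by
      rw [TensorProduct.smul_tmul', TensorProduct.smul_tmul']
      rfl
    rw [this, ← add_smul]
    congr 1
    ring
  rw [e]
  exact add_mem (Submodule.subset_span ⟨_, rfl⟩) (sum_mem fun i _ =>
    Submodule.smul_mem _ _ (Submodule.subset_span ⟨_, rfl⟩))

theorem isDivisible_submodule {K V : Type*} [Field K] [CharZero K] [AddCommGroup V] [Module K V]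
    (W : Submodule K V) : IsDivisible W.toAddSubgroup := by
  rintro m hm ⟨x, hx⟩
  refine ⟨⟨(m : K)⁻¹ • x, W.smul_mem _ hx⟩, Subtype.ext ?_⟩
  change m • ((m : K)⁻¹ • x) = x
  rw [← Nat.cast_smul_eq_nsmul K, smul_inv_smul₀ (by exact_mod_cast hm)]

theorem qdInvariant_heightGroup_of_notMem {p : Nat.Primes} (hp : p ∉ S) :
    qdInvariant (heightGroup n α c) p = ⊤ := by
  refine top_le_iff.1 ((divisiblePart_isGreatest _).2 ⟨fun y _ => ?_, ?_⟩)
  · obtain ⟨a, rfl⟩ := exists_eq_sum_smul ℚ_[(p : ℕ)] y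
    exact sum_smul_mem_pAdicSpan p a fun h => absurd h hp
  · exact isDivisible_submodule (⊤ : Submodule ℚ_[(p : ℕ)] (PAdicHull (heightGroup n α c) p))

variable (n α c) in
/-- The `ℚ_p`-linear extension of `ratFunctional α p` from `G` to `ℚ_p ⊗ G`. -/
noncomputable def hullFunctional (p : S) :
    PAdicHull (heightGroup n α c) p.1 →ₗ[ℚ_[(p.1 : ℕ)]] ℚ_[(p.1 : ℕ)] :=
  ((ratFunctional α p).toAddMonoidHom.comp
    (heightGroup n α c).subtype).toIntLinearMap.liftBaseChange _

theorem hullFunctional_one_tmul (p : S) (x : heightGroup n α c) :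
    hullFunctional n α c p (1 ⊗ₜ[ℤ] x) = ratFunctional α p (x : Fin n → ℚ) := by
  simp [hullFunctional]

theorem ratFunctional_unitVec (p : S) (i : Fin n) :
    ratFunctional α p (unitVec α c i : Fin n → ℚ) =
      (-(α p : ℚ_[(p.1 : ℕ)])) ^ (n - 1 - (i : ℕ)) := by
  simp [coe_unitVec, ratFunctional]

theorem hullFunctional_sum (p : S) (y : Fin n → ℚ_[(p.1 : ℕ)]) :
    hullFunctional n α c p (∑ i, y i • ((1 : ℚ_[(p.1 : ℕ)]) ⊗ₜ[ℤ] unitVec α c i)) =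
      padicFunctional α p y := by
  simp [hullFunctional_one_tmul, ratFunctional_unitVec, padicFunctional_apply]

theorem norm_hullFunctional_le (p : S) {y : PAdicHull (heightGroup n α c) p.1}
    (hy : y ∈ pAdicSpan (heightGroup n α c) p.1) :
    ‖hullFunctional n α c p y‖ ≤ ((p.1 : ℕ) : ℝ) ^ (c p : ℤ) := by
  induction hy using Submodule.span_induction with
  | mem y h =>
    obtain ⟨x, rfl⟩ := h
    rw [hullFunctional_one_tmul]
    exact x.2 p
  | zero => simp
  | add y z _ _ hy hz =>
    rw [map_add]
    exact (Padic.nonarchimedean _ _).trans (max_le hy hz)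
  | smul a y _ hy =>
    have : a • y = (a : ℚ_[(p.1 : ℕ)]) • y := by
      rw [← algebraMap_smul ℚ_[(p.1 : ℕ)] a y]; rfl
    rw [this, map_smul, smul_eq_mul, norm_mul]
    exact (mul_le_of_le_one_left (norm_nonneg _) a.2).trans hy

theorem ker_hullFunctional (p : S) :
    (hullFunctional n α c p).ker =
      Submodule.span ℚ_[(p.1 : ℕ)]
        {u : PAdicHull (heightGroup n α c) p.1 | ∃ (s : ℕ) (hs : s + 1 < n),
          u = hullMap (heightGroup n α c) p.1 (hullBasis n α c ⟨s, Nat.lt_of_succ_lt hs⟩) +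
            ((α p : ℤ_[(p.1 : ℕ)]) : ℚ_[(p.1 : ℕ)]) •
              hullMap (heightGroup n α c) p.1 (hullBasis n α c ⟨s + 1, hs⟩)} := by
  simp only [hullMap_hullBasis]
  set W := Submodule.span ℚ_[(p.1 : ℕ)]
        {u : PAdicHull (heightGroup n α c) p.1 | ∃ (s : ℕ) (hs : s + 1 < n),
          u = 1 ⊗ₜ[ℤ] unitVec α c ⟨s, Nat.lt_of_succ_lt hs⟩ +
            ((α p : ℤ_[(p.1 : ℕ)]) : ℚ_[(p.1 : ℕ)]) • 1 ⊗ₜ[ℤ] unitVec α c ⟨s + 1, hs⟩} with hW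
  refine le_antisymm (fun y hy => ?_) (Submodule.span_le.2 ?_)
  · rcases Nat.eq_zero_or_pos n with rfl | hn
    · obtain ⟨a, rfl⟩ := exists_eq_sum_smul _ y
      simp
    -- Modulo the span `W`, every unit vector is a multiple of the last one.
    let l : Fin n := ⟨n - 1, by omega⟩
    have key : ∀ d s (hs : s < n), n - 1 - s = d → (1 : ℚ_[(p.1 : ℕ)]) ⊗ₜ[ℤ] unitVec α c ⟨s, hs⟩ -
        (-(α p : ℚ_[(p.1 : ℕ)])) ^ d • ((1 : ℚ_[(p.1 : ℕ)]) ⊗ₜ[ℤ] unitVec α c l) ∈ W := by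
      intro d
      induction d with
      | zero =>
        intro s hs h
        obtain rfl : s = n - 1 := by omega
        simp [l]
      | succ d ih =>
        intro s hs h
        have hs' : s + 1 < n := by omega
        have h1 : (1 : ℚ_[(p.1 : ℕ)]) ⊗ₜ[ℤ] unitVec α c ⟨s, hs⟩ + (α p : ℚ_[(p.1 : ℕ)]) •
            (1 : ℚ_[(p.1 : ℕ)]) ⊗ₜ[ℤ] unitVec α c ⟨s + 1, hs'⟩ ∈ W :=
          Submodule.subset_span ⟨s, hs', rfl⟩
        convert W.sub_mem h1 (W.smul_mem (α p : ℚ_[(p.1 : ℕ)]) (ih (s + 1) hs' (by omega))) using 1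
        rw [pow_succ]
        module
    obtain ⟨a, rfl⟩ := exists_eq_sum_smul _ y
    have h0 : padicFunctional α p a = 0 := by
      rw [← hullFunctional_sum (c := c)]; exact hy
    have : ∑ i, a i • ((1 : ℚ_[(p.1 : ℕ)]) ⊗ₜ[ℤ] unitVec α c i) =
        ∑ i : Fin n, a i • ((1 : ℚ_[(p.1 : ℕ)]) ⊗ₜ[ℤ] unitVec α c i -
          (-(α p : ℚ_[(p.1 : ℕ)])) ^ (n - 1 - (i : ℕ)) •
            ((1 : ℚ_[(p.1 : ℕ)]) ⊗ₜ[ℤ] unitVec α c l)) := by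
      simp only [smul_sub, Finset.sum_sub_distrib, smul_smul]
      rw [← Finset.sum_smul, ← padicFunctional_apply, h0, zero_smul, sub_zero]
    rw [this]
    exact sum_mem fun i _ => W.smul_mem _ (key _ i i.2 rfl)
  · rintro _ ⟨s, hs, rfl⟩
    have e : n - 1 - s = (n - 1 - (s + 1)) + 1 := by omega
    rw [SetLike.mem_coe, LinearMap.mem_ker, map_add, map_smul, hullFunctional_one_tmul,
      hullFunctional_one_tmul, ratFunctional_unitVec, ratFunctional_unitVec]
    simp only [e, pow_succ, smul_eq_mul]
    ring

/-- A divisible subgroup of the `p`-adic span is killed by the functional at `p`, since the functional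
is bounded on the span; the kernel itself is divisible and lies in the span. -/
theorem qdInvariant_heightGroup (p : S) :
    qdInvariant (heightGroup n α c) p.1 = (hullFunctional n α c p).ker.toAddSubgroup := by
  refine le_antisymm ?_ ((divisiblePart_isGreatest _).2 ⟨fun y hy => ?_, isDivisible_submodule _⟩)
  · obtain ⟨hle, hdiv⟩ := (divisiblePart_isGreatest
      (pAdicSpan (heightGroup n α c) p.1).toAddSubgroup).1
    intro x hx
    have hp1 : (1 : ℝ) < ((p.1 : ℕ) : ℝ) := by exact_mod_cast p.1.2.one_lt
    by_contra hne
    have hpos : 0 < ‖hullFunctional n α c p x‖ := norm_pos_iff.2 hne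
    obtain ⟨K, hK⟩ := pow_unbounded_of_one_lt
      (((p.1 : ℕ) : ℝ) ^ (c p : ℤ) / ‖hullFunctional n α c p x‖) hp1
    obtain ⟨⟨y, hy⟩, hyx⟩ := hdiv ((p.1 : ℕ) ^ K) (pow_ne_zero _ p.1.2.ne_zero) ⟨x, hx⟩
    have hyx' : (p.1 : ℕ) ^ K • y = x := congrArg Subtype.val hyx
    have h1 := norm_hullFunctional_le p (hle hy)
    rw [div_lt_iff₀ hpos, ← hyx', map_nsmul, nsmul_eq_mul, norm_mul] at hK
    push_cast at hK
    rw [Padic.norm_p_pow, zpow_neg, zpow_natCast _ K, mul_inv_cancel_left₀ (by positivity)] at hK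
    exact hK.not_ge h1
  · obtain ⟨a, rfl⟩ := exists_eq_sum_smul _ y
    refine sum_smul_mem_pAdicSpan p.1 a fun h => ?_
    have h0 : padicFunctional α p a = 0 := by
      rw [← hullFunctional_sum (c := c)]; exact hy
    change ‖padicFunctional α p a‖ ≤ 1
    rw [h0, norm_zero]
    exact zero_le_one

/-! ### Quotient divisibility -/

variable (n α c) in
/-- The inclusion of `ℤⁿ` in the group. -/
def intEmbedding : (Fin n → ℤ) →ₗ[ℤ] heightGroup n α c :=
  AddMonoidHom.toIntLinearMap
    { toFun := fun z => ⟨fun i => (z i : ℚ), intCast_mem_heightGroup z⟩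
      map_zero' := by ext; simp
      map_add' := fun z w => by ext; simp }

/-- If `c = 0`, then `G = mG + ℤⁿ` for every `m ≠ 0`. -/
theorem exists_smul_add_intEmbedding (hn : n ≠ 0) (m : ℕ) (hm : m ≠ 0)
    (x : heightGroup n α (fun _ => 0)) :
    ∃ y z, m • y + intEmbedding n α (fun _ => 0) z = x := by
  induction m using Nat.recOnMul generalizing x with
  | zero => exact absurd rfl hm
  | one => exact ⟨x, 0, by simp⟩
  | mul a b iha ihb =>
    obtain ⟨y, z, rfl⟩ := iha (left_ne_zero_of_mul hm) x
    obtain ⟨y', z', rfl⟩ := ihb (right_ne_zero_of_mul hm) y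
    refine ⟨y', a • z' + z, ?_⟩
    rw [map_add, map_nsmul, smul_add, mul_smul, add_assoc]
  | prime q hq =>
    by_cases hqS : (⟨q, hq⟩ : Nat.Primes) ∈ S
    · let p : S := ⟨⟨q, hq⟩, hqS⟩
      let l : Fin n := ⟨n - 1, by omega⟩
      have hx : ‖ratFunctional α p (x : Fin n → ℚ)‖ ≤ 1 := by simpa using x.2 p
      -- The functional takes the value `1` at the last unit vector.
      obtain ⟨r, hr⟩ := exists_natCast_norm_sub_lt_one p.1 hx
      have hl : (intEmbedding n α (fun _ => 0) (Pi.single l (r : ℤ)) : Fin n → ℚ) =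
          (r : ℚ) • Pi.single l 1 := by
        ext j
        by_cases h : j = l
        · subst h; simp [intEmbedding]
        · simp [intEmbedding, h]
      obtain ⟨y, hy⟩ := (exists_smul_eq_iff_norm_lt p
        (x - intEmbedding n α (fun _ => 0) (Pi.single l (r : ℤ)))).2 (by
          rw [AddSubgroup.coe_sub, map_sub, hl, map_smul]
          simpa [ratFunctional, l, Algebra.smul_def] using hr)
      exact ⟨y, Pi.single l (r : ℤ), by rw [show q • y = _ from hy]; simp⟩
    · obtain ⟨y, hy⟩ := exists_pow_smul_eq_of_notMem hqS x 1
      exact ⟨y, 0, by simpa using hy⟩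

theorem isQuotientDivisible_heightGroup (hn : n ≠ 0) :
    IsQuotientDivisible (heightGroup n α (fun _ => 0)) where
  torsionFree := inferInstance
  finiteRank := by rw [rank_heightGroup]; exact Cardinal.natCast_lt_aleph0
  exists_free := by
    refine ⟨(intEmbedding n α fun _ => 0).range.toAddSubgroup, ?_, ?_, ?_⟩
    · refine Module.Free.of_equiv (LinearEquiv.ofInjective (intEmbedding n α fun _ => 0) ?_)
      intro z w h
      ext i
      have := congrFun (congrArg Subtype.val h) i
      exact Int.cast_injective (α := ℚ) this
    · intro m hm x
      obtain ⟨x, rfl⟩ := QuotientAddGroup.mk_surjective x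
      obtain ⟨y, z, rfl⟩ := exists_smul_add_intEmbedding hn m hm x
      refine ⟨y, ?_⟩
      refine ((QuotientAddGroup.mk_add_of_mem (m • y) ?_).trans rfl).symm
      exact ⟨z, rfl⟩
    · intro x
      obtain ⟨x, rfl⟩ := QuotientAddGroup.mk_surjective x
      obtain ⟨N, hN, z, hz⟩ := exists_natCast_smul_eq_intCast (x : Fin n → ℚ)
      refine isOfFinAddOrder_iff_nsmul_eq_zero.2 ⟨N, Nat.pos_of_ne_zero hN, ?_⟩
      refine (QuotientAddGroup.eq_zero_iff (N • x)).2 ⟨z, ?_⟩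
      ext i
      have := congrFun hz i
      simp only [Pi.smul_apply, smul_eq_mul] at this
      simp [this, intEmbedding]

end HeightGroup

/-! ### Characteristics of a given type -/

/-- Every type contains a characteristic given by natural numbers `c` on `P₀(t)`, and for idempotent
types `c = 0` is possible: a finite value `k` with `k + k = k` is `0`, so that an idempotent type
contains a characteristic with values `0` and `∞`. -/
theorem GroupType.exists_nat_family (t : GroupType) : ∃ c : t.PZero → ℕ,
    (∃ χ : Characteristic, GroupType.mk χ = t ∧ (∀ p, p ∉ t.PZero → χ p = ⊤) ∧
      ∀ p : t.PZero, χ p.1 = c p) ∧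
    (IsIdempotentElem t → c = fun _ => 0) := by
  induction t using Quotient.inductionOn with | h χ => ?_
  change ∃ c : (GroupType.mk χ).PZero → ℕ, _
  have hmem : ∀ p, p ∈ (GroupType.mk χ).PZero ↔ χ p ≠ ⊤ := fun p => Iff.rfl
  by_cases hid : IsIdempotentElem (GroupType.mk χ)
  · classical
    refine ⟨fun _ => 0, ⟨fun p => if χ p = ⊤ then ⊤ else 0, ?_, ?_, ?_⟩, fun _ => rfl⟩
    · obtain ⟨h1, -⟩ : Characteristic.Equiv (fun p => χ p + χ p) χ := Quotient.exact hid
      refine Quotient.sound ⟨h1.subset fun p hp => ?_, fun p hp => ?_⟩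
      · by_cases h : χ p = ⊤
        · exact absurd (by simp [h]) hp
        · intro h2
          apply hp
          lift χ p to ℕ using h with k hk
          have : k + k = k := by exact_mod_cast h2
          obtain rfl : k = 0 := by omega
          simp
      · by_cases h : χ p = ⊤
        · exact absurd (by simp [h]) hp
        · simp [h]
    · intro p hp
      have : χ p = ⊤ := by_contra fun h => hp ((hmem p).2 h)
      simp [this]
    · intro p
      have := (hmem p.1).1 p.2
      simp [this]
  · refine ⟨fun p => (χ p.1).toNat, ⟨χ, rfl, fun p hp => ?_, fun p => ?_⟩, fun h => absurd h hid⟩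
    · exact by_contra fun h => hp ((hmem p).2 h)
    · exact (ENat.natCast_toNat ((hmem p.1).1 p.2)).symm

theorem GroupType.PZero_nonempty {t : GroupType} (ht : t ≠ GroupType.mk (fun _ => ⊤)) :
    t.PZero.Nonempty := by
  obtain ⟨c, ⟨χ, rfl, h, -⟩, -⟩ := t.exists_nat_family
  by_contra he
  rw [Set.not_nonempty_iff_eq_empty] at he
  exact ht (congrArg GroupType.mk (funext fun p => h p (by simp [he])))

end AbelianGroups

theorem lemma13 (n : ℕ) (hn : 1 < n) (t : AbelianGroups.GroupType)
    (ht : t ≠ AbelianGroups.GroupType.mk (fun _ => ⊤))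
    (α : ∀ p : t.PZero, ℤ_[(p.1 : ℕ)]) (hα : AbelianGroups.ConditionT α (n - 1)) :
    ∃ (G : Type) (_ : AddCommGroup G),
      AbelianGroups.IsMurley G ∧
      AbelianGroups.IsHomogeneousOfType G t ∧
      Module.rank ℤ G = n ∧
      (∃ e : Module.Basis (Fin n) ℚ (AbelianGroups.DivisibleHull G),
        (∀ p ∈ t.PInfty, AbelianGroups.qdInvariant G p = ⊤) ∧
        (∀ p : t.PZero, AbelianGroups.qdInvariant G p.1 =
          (Submodule.span ℚ_[(p.1 : ℕ)]
            {u : AbelianGroups.PAdicHull G p.1 | ∃ (s : ℕ) (hs : s + 1 < n),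
              u = AbelianGroups.hullMap G p.1 (e ⟨s, Nat.lt_of_succ_lt hs⟩) +
                ((α p : ℤ_[(p.1 : ℕ)]) : ℚ_[(p.1 : ℕ)]) •
                  AbelianGroups.hullMap G p.1 (e ⟨s + 1, hs⟩)}).toAddSubgroup)) ∧
      (IsIdempotentElem t → AbelianGroups.IsQuotientDivisible G) := by
  obtain ⟨c, ⟨χ, hχ, hχS, hχc⟩, hidem⟩ := t.exists_nat_family
  refine ⟨AbelianGroups.heightGroup n α c, inferInstance,
    AbelianGroups.isMurley_heightGroup hα (AbelianGroups.GroupType.PZero_nonempty ht),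
    fun g hg => (AbelianGroups.elementType_heightGroup hα hχS hχc hg).trans hχ,
    AbelianGroups.rank_heightGroup,
    ⟨AbelianGroups.hullBasis n α c,
      fun p hp => AbelianGroups.qdInvariant_heightGroup_of_notMem fun h => h hp,
      fun p => by
        rw [AbelianGroups.qdInvariant_heightGroup, AbelianGroups.ker_hullFunctional]⟩,
    fun ht => ?_⟩
  obtain rfl := hidem ht
  exact AbelianGroups.isQuotientDivisible_heightGroup (by omega)
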